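/- Let $\mathcal L$ be a finite relational language. A hereditary class $\mathcal H$ of $\mathcal L$-structures is a class of finite $\mathcal L$-structures closed under isomorphism and under induced substructures; a possibly infinite $\mathcal L$-structure is said to belong to $\mathcal H$ if all its finite substructures do. For tuples $X,Y$ of the same length in $\mathcal L$-structures, $X\equiv Y$ means that they have the same quantifier-free type (equality included), i.e. that matching the entries gives an isomorphism of the substructures they enumerate. For a real number $r\ge 3$, $\mathcal H$ is $\mathrm{NSOP}_r$ if the following holds for every finite $\mathcal L$-structure enumerated as a concatenation $AB$ of two tuples of the same length: if there are tuples $\{A_i\}_{i<\omega}$ in some structure belonging to $\mathcal H$ with $A_iA_j\equiv AB$ for all $i<j$, then there are tuples $\{A_\theta\}_{\theta\in S^1}$ in some structure belonging to $\mathcal H$, indexed by the unit circle $S^1$, with $A_\theta A_\psi\equiv AB$ for all distinct $\theta,\psi\in S^1$ such that $\psi$ lies at most $\frac{2\pi}{r}$ radians counterclockwise from $\theta$. Otherwise $\mathcal H$ has $\mathrm{SOP}_r$. Let $\mathfrak o(\mathcal H)\in[0,\infty]$ be the supremum of the real numbers $r\ge 3$ such that $\mathcal H$ has $\mathrm{SOP}_r$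 (with $\mathfrak o(\mathcal H)=0$ if there are none). A weak embedding is an injective map $\iota:B\to A$ of $\mathcal L$-structures that preserves (but need not reflect) all relations. The class $\mathcal H$ is defined by a finite family of forbidden weakly embedded substructures if there is a finite family $\mathcal F$ of finite $\mathcal L$-structures such that $\mathcal H$ consists of exactly the finite $\mathcal L$-structures $A$ for which no $B\in\mathcal F$ has a weak embedding into $A$. **Theorem.** Let $\mathcal H$ be a hereditary class defined by a finite family of forbidden weakly embedded substructures. Then $\mathfrak o(\mathcal H)$ is a (finite) integer. Moreover, for every real number $r\ge 3$, if $\mathcal H$ has $\mathrm{SOP}_r$, then $\mathcal H$ has $\mathrm{SOP}_n$ for $n=\lceil r\rceil$. -/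

import Mathlib

open scoped FirstOrder

universe u v

/-- A hereditary class of finite `L`-structures, for a relational language `L`. The field
`hereditary` is Mathlib's hereditary property: if `M` is in the class and the finitely generated
(that is, finite, as `L` is relational) structure `N` embeds into `M` as an induced substructure,
then `N` is in the class. In particular the class is closed under isomorphism. -/
structure HereditaryClass (L : FirstOrder.Language.{u, v}) [L.IsRelational] where
  carrier : Set (CategoryTheory.Bundled.{0} L.Structure)
  finite : ∀ M ∈ carrier, Finite M
  hereditary : FirstOrder.Language.Hereditary carrier

/-- There is a weak embedding of `A` into `B`: an injective map which preserves, but need not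
reflect, the relations. -/
def WeaklyEmbeds (L : FirstOrder.Language.{u, v}) (A B : Type) [L.Structure A] [L.Structure B] : Prop :=
  ∃ f : A →[L] B, Function.Injective f

/-- Two tuples with the same index set, in two structures, are equivalent: `x i ↦ y i` is a
well-defined isomorphism between the induced substructures that the tuples enumerate. In other
words, the tuples have the same quantifier-free type (equality included). -/
def TupleEquiv (L : FirstOrder.Language.{u, v}) {M N : Type} [L.Structure M] [L.Structure N] {ι : Type}
    (x : ι → M) (y : ι → N) : Prop :=
  (∀ i j, x i = x j ↔ y i = y j) ∧
    ∀ (n : ℕ) (R : L.Relations n) (s : Fin n → ι),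
      FirstOrder.Language.Structure.RelMap R (x ∘ s) ↔ FirstOrder.Language.Structure.RelMap R (y ∘ s)

/-- The concatenation of two tuples of the same length. -/
def pairTuple {M : Type} {k : ℕ} (a b : Fin k → M) : Fin k ⊕ Fin k → M :=
  Sum.elim a b

/-- The point `ψ` of the unit circle, distinct from `θ`, lies at most `2π/r` radians
counterclockwise from `θ` (used for `r ≥ 3`). -/
def WithinCCW (r : ℝ) (θ ψ : Circle) : Prop :=
  ∃ t : ℝ, 0 < t ∧ t ≤ 2 * Real.pi / r ∧ ψ = Circle.exp t * θ

namespace HereditaryClass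

variable {L : FirstOrder.Language.{u, v}} [L.IsRelational]

/-- The possibly infinite structure `A` belongs to `H`, in the sense that all its finite
substructures do. -/
def Contains (H : HereditaryClass L) (A : Type) [L.Structure A] : Prop :=
  L.age A ⊆ H.carrier

/-- `H(F)`: the class of the finite structures into which no structure of `F` weakly embeds. -/
def forb (F : Set (CategoryTheory.Bundled.{0} L.Structure)) : HereditaryClass L where
  carrier := {A | Finite A ∧ ∀ B ∈ F, ¬ WeaklyEmbeds L B A}
  finite := fun _ h => h.1
  hereditary := by
    rintro M ⟨hM, hF⟩ N ⟨-, ⟨e⟩⟩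
    refine ⟨Finite.of_injective e e.injective, fun B hB => ?_⟩
    rintro ⟨f, hf⟩
    exact hF B hB ⟨e.toHom.comp f, e.injective.comp hf⟩

/-- `H` is defined by a finite family of forbidden weakly embedded (finite) substructures. -/
def DefinedByFiniteFamily (H : HereditaryClass L) : Prop :=
  ∃ F : Set (CategoryTheory.Bundled.{0} L.Structure),
    F.Finite ∧ (∀ B ∈ F, Finite B) ∧ H = forb F

/-- There is a sequence `A₀, A₁, …` of tuples in a structure belonging to `H`, such that
`AᵢAⱼ ≡ ab` for all `i < j`. -/
def HasSequence (H : HereditaryClass L) {M : Type} [L.Structure M] {k : ℕ}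
    (a b : Fin k → M) : Prop :=
  ∃ (X : Type) (_ : L.Structure X), H.Contains X ∧
    ∃ A : ℕ → Fin k → X, ∀ i j, i < j → TupleEquiv L (pairTuple (A i) (A j)) (pairTuple a b)

/-- There is a family of tuples `A_θ` in a structure belonging to `H`, indexed by the unit circle,
such that `A_θ A_ψ ≡ ab` whenever `ψ` lies at most `2π/r` radians counterclockwise from `θ`. -/
def HasCircle (H : HereditaryClass L) (r : ℝ) {M : Type} [L.Structure M] {k : ℕ}
    (a b : Fin k → M) : Prop :=
  ∃ (X : Type) (_ : L.Structure X), H.Contains X ∧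
    ∃ A : Circle → Fin k → X, ∀ θ ψ, WithinCCW r θ ψ →
      TupleEquiv L (pairTuple (A θ) (A ψ)) (pairTuple a b)

/-- The property `NSOP_r` (for `r ≥ 3`): whenever a finite structure, enumerated as a
concatenation `ab` of two tuples, is realized by all pairs `i < j` of an infinite sequence in `H`,
it is realized along the unit circle in `H`. The lengths of `a` and `b` agree because the middle
terms of a sequence play the role of both. -/
def NSOP (H : HereditaryClass L) (r : ℝ) : Prop :=
  ∀ (M : Type) [L.Structure M] (k : ℕ) (a b : Fin k → M),
    Function.Surjective (pairTuple a b) → H.HasSequence a b → H.HasCircle r a b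

/-- The property `SOP_r` (for `r ≥ 3`). -/
def SOP (H : HereditaryClass L) (r : ℝ) : Prop :=
  ¬ H.NSOP r

/-- The possibly infinite quantity `𝔬(H)`: the supremum in `[0, ∞]` of the reals `r ≥ 3` such that
some finite structure `ab` is realized by a sequence in `H` but not along the circle with
parameter `r`, which is to say that `H` has `SOP_r`. It is `0` if there is no such `r`. -/
noncomputable def sopRank (H : HereditaryClass L) : ENNReal :=
  ⨆ (r : ℝ) (_ : 3 ≤ r ∧ H.SOP r), ENNReal.ofReal r

end HereditaryClass

open scoped FirstOrder

/-! A pair type realized by a sequence can be laid freely along any digraph `D`: one copy of the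
moving part per vertex, a common constant part, and only the relations forced by vertices and
arrows. As the forbidden structures are weakly embedded, any structure realizing the type along `D`
with distinct copies contains this `P.Free D` weakly, so everything reduces to asking which free
structures lie in the class. Let `N` exceed the sizes of all forbidden structures. Membership
depends only on small sets of vertices. If `D` has no closed walk of length at most `N`, these sets
can be topologically ordered, and `P.Free D` is locally a weak substructure of the free structure
along `ℕ` (`contains_free_of_no_closedWalk`). Under `NSOP n`, with `n` an integer, the absence of
closed walks of length less than `n` suffices (`NSOP.contains_free`). This goes by downward
induction on the least allowed length `m`: a set of vertices mapping to the directed `m`-cycle is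
unrolled into levels; shifting levels gives a sequence, `NSOP n` bends it around the circle, and `m`
equally spaced points roll it up again (`NSOP.contains_free_of_unroll`). Unrolling all such sets
destroys every closed walk of length `m`. A closed walk around the circle with steps of at most
`2π/r` has length at least `r`, hence at least `⌈r⌉`. So `NSOP ⌈r⌉` implies `NSOP r`, and `NSOP r`
always holds for `r > N`. The rank is therefore a supremum of a bounded set of integers. -/

theorem WeaklyEmbeds.trans {L : FirstOrder.Language.{u, v}} {A B C : Type} [L.Structure A]
    [L.Structure B] [L.Structure C]
    (h₁ : WeaklyEmbeds L A B) (h₂ : WeaklyEmbeds L B C) : WeaklyEmbeds L A C := by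
  obtain ⟨f, hf⟩ := h₁
  obtain ⟨g, hg⟩ := h₂
  exact ⟨g.comp f, hg.comp hf⟩

/-! ### Membership tested by weak embeddings -/

namespace HereditaryClass

variable {L : FirstOrder.Language.{u, v}} [L.IsRelational]

/-- A relation-preserving map between structures for a relational language, as a homomorphism. -/
def homOfRel {M N : Type} [L.Structure M] [L.Structure N] (f : M → N)
    (h : ∀ (n : ℕ) (R : L.Relations n) (x : Fin n → M),
      FirstOrder.Language.Structure.RelMap R x →
        FirstOrder.Language.Structure.RelMap R (f ∘ x)) : M →[L] N where
  toFun := f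
  map_fun' := fun F => isEmptyElim F
  map_rel' := fun R x => h _ R x

theorem contains_forb_iff {F : Set (CategoryTheory.Bundled.{0} L.Structure)}
    (hF : ∀ B ∈ F, Finite B) (X : Type) [L.Structure X] :
    (forb F).Contains X ↔ ∀ B ∈ F, ¬ WeaklyEmbeds L B X := by
  constructor
  · rintro h B hB ⟨f, hf⟩
    have := hF B hB
    let S : L.Substructure X := ⟨Set.range f, fun F => isEmptyElim F⟩
    have hS : Finite S := Set.finite_range f
    have hmem : (⟨S, inferInstance⟩ : CategoryTheory.Bundled.{0} L.Structure) ∈ L.age X :=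
      ⟨FirstOrder.Language.Structure.FG.of_finite, ⟨S.subtype⟩⟩
    refine (h hmem).2 B hB ⟨f.codRestrict S fun c => ⟨c, rfl⟩, fun x y hxy => hf ?_⟩
    exact congrArg Subtype.val hxy
  · rintro h N ⟨hN, ⟨e⟩⟩
    refine ⟨FirstOrder.Language.Structure.FG.finite hN, fun B hB hBN => h B hB ?_⟩
    exact WeaklyEmbeds.trans hBN ⟨e.toHom, e.injective⟩

/-- This monotonicity is where forbidding weak, rather than induced, substructures is used: a free
structure has the fewest relations, so it inherits membership from any other realization. -/
theorem Contains.of_weaklyEmbeds {F : Set (CategoryTheory.Bundled.{0} L.Structure)}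
    (hF : ∀ B ∈ F, Finite B) {X Y : Type} [L.Structure X] [L.Structure Y]
    (hX : (forb F).Contains X) (h : WeaklyEmbeds L Y X) : (forb F).Contains Y := by
  rw [contains_forb_iff hF] at hX ⊢
  exact fun B hB hBY => hX B hB (WeaklyEmbeds.trans hBY h)

end HereditaryClass

/-! ### Free structures along digraphs -/

/-- Forget which of the vertices an element of `C ⊕ V × T` belongs to, and relabel it. -/
def relabel {C T V W : Type} (g : V → W) : C ⊕ V × T → C ⊕ W × T :=
  Sum.map id (Prod.map g id)

/-- The copy of the coordinates at the vertex `v`. -/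
def place {C T V : Type} (v : V) : C ⊕ T → C ⊕ V × T :=
  Sum.map id (Prod.mk v)

section relabel

variable {C T V W : Type}

@[simp] theorem relabel_inl (g : V → W) (c : C) : relabel (T := T) g (Sum.inl c) = Sum.inl c := rfl

@[simp] theorem relabel_inr (g : V → W) (v : V) (t : T) :
    relabel (C := C) g (Sum.inr (v, t)) = Sum.inr (g v, t) := rfl

@[simp] theorem place_inl (v : V) (c : C) : place (T := T) v (Sum.inl c) = Sum.inl c := rfl

@[simp] theorem place_inr (v : V) (t : T) : place (C := C) v (Sum.inr t) = Sum.inr (v, t) := rfl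

theorem relabel_injective {g : V → W} (hg : Function.Injective g) :
    Function.Injective (relabel (C := C) (T := T) g) :=
  Function.Injective.sumMap Function.injective_id (hg.prodMap Function.injective_id)

theorem relabel_comp_place (g : V → W) (v : V) :
    relabel (C := C) (T := T) g ∘ place v = place (g v) := by
  funext x; rcases x with c | t <;> rfl

theorem relabel_comp_relabel {U : Type} (g : V → W) (f : U → V) :
    relabel (C := C) (T := T) g ∘ relabel f = relabel (g ∘ f) := by
  funext x; rcases x with c | t <;> rfl

end relabel

/-- The quantifier-free relational content of a pair of tuples with common part `C` and moving
part `T`, both of whose sides have the same type over the common part. -/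
structure PairType (L : FirstOrder.Language.{u, v}) (C T : Type) where
  rel : ∀ {r : ℕ}, L.Relations r → (Fin r → C ⊕ Bool × T) → Prop
  flip : ∀ {r : ℕ} (R : L.Relations r) (y : Fin r → C ⊕ T),
    rel R (place false ∘ y) ↔ rel R (place true ∘ y)

namespace PairType

variable {L : FirstOrder.Language.{u, v}} {C T : Type}

/-- The domain of the free structure along a digraph `D`, which has one copy of the moving part for
every vertex. -/
def Free (_ : PairType L C T) {V : Type} (_ : V → V → Prop) : Type := C ⊕ V × T

/-- The relations forced by the vertices and the arrows of `D`. -/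
def FreeRel (P : PairType L C T) {V : Type} (D : V → V → Prop) {r : ℕ} (R : L.Relations r)
    (z : Fin r → C ⊕ V × T) : Prop :=
  (∃ (v : V) (y : Fin r → C ⊕ T), z = place v ∘ y ∧ P.rel R (place false ∘ y)) ∨
    ∃ (g : Bool → V) (y : Fin r → C ⊕ Bool × T), D (g false) (g true) ∧
      (∀ b, ∃ l t, y l = Sum.inr (b, t)) ∧ z = relabel g ∘ y ∧ P.rel R y

instance [L.IsRelational] (P : PairType L C T) {V : Type} (D : V → V → Prop) :
    L.Structure (P.Free D) where
  funMap := fun F => isEmptyElim F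
  RelMap := fun R z => P.FreeRel D R z

/-- A relation forced by an arrow must involve both of its ends, so only arrows between vertices
occurring in `z` need to be preserved. -/
theorem FreeRel.map {P : PairType L C T} {V W : Type} {D : V → V → Prop} {E : W → W → Prop}
    {r : ℕ} {R : L.Relations r} {z : Fin r → C ⊕ V × T} (h : P.FreeRel D R z) (φ : V → W)
    (hφ : ∀ v w, (∃ l t, z l = Sum.inr (v, t)) → (∃ l t, z l = Sum.inr (w, t)) → D v w →
      E (φ v) (φ w)) : P.FreeRel E R (relabel φ ∘ z) := by
  rcases h with ⟨v, y, rfl, hy⟩ | ⟨g, y, hD, hs, rfl, hy⟩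
  · exact Or.inl ⟨φ v, y, by rw [← Function.comp_assoc, relabel_comp_place], hy⟩
  · refine Or.inr ⟨φ ∘ g, y, hφ _ _ ?_ ?_ hD, hs, ?_, hy⟩
    · obtain ⟨l, t, h⟩ := hs false
      exact ⟨l, t, by simp [h]⟩
    · obtain ⟨l, t, h⟩ := hs true
      exact ⟨l, t, by simp [h]⟩
    · rw [← Function.comp_assoc, relabel_comp_relabel]

/-- For the converse, pull back along `Function.invFun φ`; vertices outside the range of `φ` do not
occur in the tuple, so arrows there are harmless. -/
theorem freeRel_map_iff {P : PairType L C T} {V W : Type} [Nonempty V] {D : V → V → Prop}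
    {E : W → W → Prop} {r : ℕ} {R : L.Relations r} {z : Fin r → C ⊕ V × T} (φ : V → W)
    (hφ : Function.Injective φ) (hDE : ∀ v w, D v w ↔ E (φ v) (φ w)) :
    P.FreeRel E R (relabel φ ∘ z) ↔ P.FreeRel D R z := by
  refine ⟨fun h => ?_, fun h => h.map φ fun v w _ _ => (hDE v w).1⟩
  have hinv := Function.leftInverse_invFun hφ
  have key := h.map (E := D) (Function.invFun φ) ?_
  · rwa [← Function.comp_assoc, relabel_comp_relabel, hinv.comp_eq_id, show
      relabel (C := C) (T := T) (id : V → V) = id by funext x; rcases x with c | t <;> rfl,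
      Function.id_comp] at key
  · have hr : ∀ w, (∃ l t, (relabel φ ∘ z) l = Sum.inr (w, t)) → ∃ v, φ v = w := by
      rintro w ⟨l, t, h⟩
      rcases hz : z l with c | ⟨v, t'⟩
      · simp [hz] at h
      · simp only [Function.comp_apply, hz, relabel_inr, Sum.inr.injEq, Prod.mk.injEq] at h
        exact ⟨v, h.1⟩
    intro w w' hw hw' hE
    obtain ⟨v, rfl⟩ := hr w hw
    obtain ⟨v', rfl⟩ := hr w' hw'
    rw [hinv v, hinv v']
    exact (hDE _ _).2 hE

/-- Along an arrow of an oriented graph, the free structure realizes exactly the given type. -/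
theorem freeRel_relabel_iff {P : PairType L C T} {V : Type} {D : V → V → Prop}
    (hirr : ∀ v, ¬ D v v) (hasymm : ∀ v w, D v w → ¬ D w v) {g : Bool → V}
    (hg : D (g false) (g true)) {r : ℕ} (R : L.Relations r) (y : Fin r → C ⊕ Bool × T) :
    P.FreeRel D R (relabel g ∘ y) ↔ P.rel R y := by
  have hne : g false ≠ g true := fun h => hirr (g true) (by rwa [h] at hg)
  have hginj : Function.Injective g := by
    intro b b' h
    cases b <;> cases b' <;> simp_all
  have hsingle : ∀ (b : Bool) (y₀ : Fin r → C ⊕ T),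
      P.rel R (place false ∘ y₀) ↔ P.rel R (place b ∘ y₀) := by
    rintro (_ | _) y₀
    · rfl
    · exact P.flip R y₀
  constructor
  · rintro (⟨v, y₀, h, hy⟩ | ⟨g', y', hD, hs, h, hy⟩)
    · have : ∃ b : Bool, y = place b ∘ y₀ := by
        by_cases hv : ∃ b, g b = v
        · obtain ⟨b, rfl⟩ := hv
          refine ⟨b, (relabel_injective hginj).comp_left ?_⟩
          simp only
          rw [h, ← Function.comp_assoc, relabel_comp_place]
        -- If `v` is not an end of the arrow, the tuple has only constant entries and either side
        -- will do.
        · refine ⟨false, funext fun l => ?_⟩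
          have hl := congrFun h l
          rcases hyl : y l with c | ⟨b, t⟩ <;> rcases hyl' : y₀ l with c' | t' <;>
            simp [hyl, hyl'] at hl ⊢
          · exact hl
          · exact (hv ⟨b, hl.1⟩).elim
      obtain ⟨b, rfl⟩ := this
      exact (hsingle b y₀).1 hy
    · have hr : ∀ b, ∃ b', g b' = g' b := by
        intro b
        obtain ⟨l, t, hl⟩ := hs b
        have h' := congrFun h l
        rcases hyl : y l with c | ⟨b', t'⟩ <;> simp [hl, hyl] at h'
        exact ⟨b', h'.1⟩
      -- The forcing arrow joins the same two vertices; having neither loops nor 2-cycles excludes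
      -- everything but `g`.
      have hgg : g' = g := by
        obtain ⟨b₀, h₀⟩ := hr false
        obtain ⟨b₁, h₁⟩ := hr true
        rw [← h₀, ← h₁] at hD
        funext b
        cases b₀ <;> cases b₁
        · exact (hirr _ hD).elim
        · cases b
          · exact h₀.symm
          · exact h₁.symm
        · exact (hasymm _ _ hg hD).elim
        · exact (hirr _ hD).elim
      subst hgg
      have : y = y' := (relabel_injective hginj).comp_left h
      rwa [this]
  · intro hy
    by_cases hs : ∀ b, ∃ l t, y l = Sum.inr (b, t)
    · exact Or.inr ⟨g, y, hg, hs, rfl, hy⟩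
    · push Not at hs
      obtain ⟨b, hb⟩ := hs
      have : ∃ y₀ : Fin r → C ⊕ T, y = place (!b) ∘ y₀ := by
        have : ∀ l, ∃ x : C ⊕ T, y l = place (!b) x := by
          intro l
          rcases hyl : y l with c | ⟨b', t⟩
          · exact ⟨Sum.inl c, rfl⟩
          · refine ⟨Sum.inr t, ?_⟩
            have : b' ≠ b := by rintro rfl; exact hb l t hyl
            cases b <;> cases b' <;> simp_all
        choose y₀ hy₀ using this
        exact ⟨y₀, funext hy₀⟩
      obtain ⟨y₀, rfl⟩ := this
      refine Or.inl ⟨g !b, y₀, ?_, (hsingle _ y₀).2 hy⟩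
      rw [← Function.comp_assoc, relabel_comp_place]

end PairType

/-! ### From a sequence to a pair type -/

namespace HereditaryClass

variable {L : FirstOrder.Language.{u, v}} [L.IsRelational]

/-- The type of a pair realized by a sequence decomposes into a constant part, a moving part and
the relations on them. The sequence itself becomes the free structure along the natural numbers, and
the type of the pair is realized along the arrows of every oriented graph. -/
theorem HasSequence.exists_pairType {F : Set (CategoryTheory.Bundled.{0} L.Structure)}
    (hF : ∀ B ∈ F, Finite B) {M : Type} [L.Structure M] {k : ℕ} {a b : Fin k → M}
    (h : (forb F).HasSequence a b) :
    ∃ (C T : Type) (_ : Finite C) (_ : Finite T) (P : PairType L C T) (coord : Fin k → C ⊕ T),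
      (forb F).Contains (P.Free (fun i j : ℕ => i < j)) ∧
      ∀ (V : Type) (D : V → V → Prop), (∀ v, ¬ D v v) → (∀ v w, D v w → ¬ D w v) →
        ∀ v w, D v w → TupleEquiv L (M := P.Free D)
          (pairTuple (M := P.Free D) (place v ∘ coord) (place w ∘ coord)) (pairTuple a b) := by
  classical
  obtain ⟨X, _, hX, A, hA⟩ := h
  have eqL : ∀ i p q, A i p = A i q ↔ a p = a q := fun i p q =>
    (hA i (i + 1) i.lt_succ_self).1 (Sum.inl p) (Sum.inl q)
  have eqR : ∀ i p q, A (i + 1) p = A (i + 1) q ↔ b p = b q := fun i p q =>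
    (hA i (i + 1) i.lt_succ_self).1 (Sum.inr p) (Sum.inr q)
  have eqLR : ∀ i j p q, i < j → (A i p = A j q ↔ a p = b q) := fun i j p q hij =>
    (hA i j hij).1 (Sum.inl p) (Sum.inr q)
  have hab : ∀ p q, a p = a q ↔ b p = b q := fun p q => (eqL 1 p q).symm.trans (eqR 0 p q)
  -- Both `A 0 p` and `A 1 p` equal `A 2 q`, so position `p` is constant.
  have hconst : ∀ p q, a p = b q → a p = b p := fun p q h => by
    rw [← eqLR 0 1 p p one_pos, (eqLR 0 2 p q two_pos).2 h, (eqLR 1 2 p q one_lt_two).2 h]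
  have hrel : ∀ (n : ℕ) (R : L.Relations n) (s : Fin n → Fin k),
      FirstOrder.Language.Structure.RelMap R (a ∘ s) ↔
        FirstOrder.Language.Structure.RelMap R (b ∘ s) := fun n R s =>
    ((hA 1 2 one_lt_two).2 n R (Sum.inl ∘ s)).symm.trans ((hA 0 1 one_pos).2 n R (Sum.inr ∘ s))
  let C := {t : M // ∃ p, a p = t ∧ b p = t}
  let T := {t : M // ∃ p, a p = t ∧ b p ≠ t}
  have hC : Finite C := (Set.finite_range a).subset (by rintro t ⟨p, hp, -⟩; exact ⟨p, hp⟩)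
  have hT : Finite T := (Set.finite_range a).subset (by rintro t ⟨p, hp, -⟩; exact ⟨p, hp⟩)
  choose pc hpc hpc' using fun c : C => c.2
  choose pt hpt hpt' using fun t : T => t.2
  let σ : C ⊕ Bool × T → Fin k ⊕ Fin k :=
    Sum.elim (fun c => Sum.inl (pc c)) fun x => if x.1 then Sum.inr (pt x.2) else Sum.inl (pt x.2)
  let d : C ⊕ Bool × T → M := pairTuple a b ∘ σ
  have hdc : ∀ c, d (Sum.inl c) = c.1 := hpc
  have hdf : ∀ t, d (Sum.inr (false, t)) = t.1 := hpt
  have hdt : ∀ t, d (Sum.inr (true, t)) = b (pt t) := fun t => rfl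
  have hnotc : ∀ (t : T) p, t.1 = b p → False := fun t p h => by
    rw [← hpt] at h
    exact hpt' t (by rw [← hconst _ _ h, hpt])
  have hnotc' : ∀ (t : T) (c : C), t.1 ≠ c.1 := fun t c h => hnotc t (pc c) (by rw [h, hpc'])
  have hbpt : ∀ (t t' : T), b (pt t) = b (pt t') → t = t' := fun t t' h => by
    rw [← hab, hpt, hpt] at h
    exact Subtype.ext h
  have hbptc : ∀ (t : T) (c : C), b (pt t) ≠ c.1 := fun t c h => by
    rw [← hpc' c, ← hab, hpt, hpc] at h
    exact hnotc' _ _ h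
  have hdinj : Function.Injective d := by
    rintro (c | ⟨_ | _, t⟩) (c' | ⟨_ | _, t'⟩) h <;> simp only [hdc, hdf, hdt] at h
    · rw [Subtype.ext h]
    · exact (hnotc' _ _ h.symm).elim
    · exact (hbptc _ _ h.symm).elim
    · exact (hnotc' _ _ h).elim
    · rw [Subtype.ext h]
    · exact (hnotc _ _ h).elim
    · exact (hbptc _ _ h).elim
    · exact (hnotc _ _ h.symm).elim
    · rw [hbpt _ _ h]
  let P : PairType L C T :=
    { rel := fun R y => FirstOrder.Language.Structure.RelMap R (d ∘ y)
      flip := fun R y => by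
        have e₀ : d ∘ place false ∘ y = a ∘ Sum.elim pc pt ∘ y := by
          funext l
          rcases hy : y l with c | t <;> simp [hy, hdc, hdf, hpc, hpt]
        have e₁ : d ∘ place true ∘ y = b ∘ Sum.elim pc pt ∘ y := by
          funext l
          rcases hy : y l with c | t <;> simp [hy, hdc, hdt, hpc']
        rw [e₀, e₁]
        exact hrel _ R _ }
  let coord : Fin k → C ⊕ T := fun p =>
    if h : a p = b p then Sum.inl ⟨a p, p, rfl, h.symm⟩ else Sum.inr ⟨a p, p, rfl, Ne.symm h⟩
  have hcoord : ∀ x, d (pairTuple (place false ∘ coord) (place true ∘ coord) x)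
      = pairTuple a b x := by
    rintro (p | p) <;> by_cases hp : a p = b p <;>
      simp only [pairTuple, Sum.elim_inl, Sum.elim_inr, Function.comp_apply, coord, hp, dif_pos,
        dif_neg, not_false_eq_true, place_inl, place_inr, hdc, hdf, hdt]
    rw [← hab, hpt]
  refine ⟨C, T, hC, hT, P, coord, ?_, ?_⟩
  · refine hX.of_weaklyEmbeds hF ?_
    let e : C ⊕ ℕ × T → X := Sum.elim (fun c => A 0 (pc c)) fun x => A x.1 (pt x.2)
    have hA0 : ∀ i c, A i (pc c) = A 0 (pc c) := fun i c => by
      rcases i.eq_zero_or_pos with rfl | hi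
      · rfl
      · exact ((eqLR 0 i _ _ hi).2 (by rw [hpc, hpc'])).symm
    have hpair : ∀ (g : Bool → ℕ), g false < g true → ∀ (r : ℕ) (R : L.Relations r)
        (y : Fin r → C ⊕ Bool × T), P.rel R y →
        FirstOrder.Language.Structure.RelMap R (e ∘ relabel g ∘ y) := by
      intro g hg r R y hy
      have : e ∘ relabel g ∘ y = pairTuple (A (g false)) (A (g true)) ∘ σ ∘ y := by
        funext l
        rcases hyl : y l with c | ⟨_ | _, t⟩ <;> simp [hyl, e, σ, pairTuple]
        exact (hA0 _ _).symm
      rw [this]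
      exact ((hA _ _ hg).2 r R _).2 hy
    refine ⟨homOfRel (M := P.Free _) e ?_, ?_⟩
    · rintro r R z (⟨v, y, rfl, hy⟩ | ⟨g, y, hg, -, rfl, hy⟩)
      -- A relation at one vertex is read off along the arrow `v < v + 1`.
      · have := hpair (fun b => if b then v + 1 else v) (by simp) r R _ hy
        rwa [← Function.comp_assoc (relabel _), relabel_comp_place] at this
      · exact hpair g hg r R y hy
    · have key : ∀ i j t t', i < j → A i (pt t) ≠ A j (pt t') := fun i j t t' hij h => by
        rw [eqLR i j _ _ hij, hpt] at h
        exact hnotc _ _ h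
      change Function.Injective e
      rintro (c | ⟨i, t⟩) (c' | ⟨j, t'⟩) h
      · have h' : A 0 (pc c) = A 0 (pc c') := h
        rw [eqL, hpc, hpc] at h'
        rw [Subtype.ext h']
      · have h' : A 0 (pc c) = A j (pt t') := h
        rw [← hA0 j, eqL, hpc, hpt] at h'
        exact (hnotc' _ _ h'.symm).elim
      · have h' : A i (pt t) = A 0 (pc c') := h
        rw [← hA0 i, eqL, hpc, hpt] at h'
        exact (hnotc' _ _ h').elim
      · have h' : A i (pt t) = A j (pt t') := h
        rcases lt_trichotomy i j with hij | rfl | hij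
        · exact (key _ _ _ _ hij h').elim
        · rw [eqL, hpt, hpt] at h'
          rw [Subtype.ext h']
        · exact (key _ _ _ _ hij h'.symm).elim
  · intro V D hirr hasymm v w hvw
    let g : Bool → V := fun b => if b then w else v
    have hginj : Function.Injective g := by
      have : v ≠ w := fun h => hirr w (by rwa [h] at hvw)
      rintro (_ | _) (_ | _) h <;> simp_all [g]
    have hpt : ∀ x, pairTuple (M := P.Free D) (place v ∘ coord) (place w ∘ coord) x =
        relabel g (pairTuple (place false ∘ coord) (place true ∘ coord) x) := by
      rintro (p | p)
      · exact (congrFun (relabel_comp_place g false) (coord p)).symm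
      · exact (congrFun (relabel_comp_place g true) (coord p)).symm
    refine ⟨fun x y => ?_, fun n R s => ?_⟩
    · rw [hpt, hpt, ← hcoord, ← hcoord, hdinj.eq_iff]
      exact (relabel_injective hginj).eq_iff
    · have e₁ : pairTuple (M := P.Free D) (place v ∘ coord) (place w ∘ coord) ∘ s =
        relabel g ∘ pairTuple (place false ∘ coord) (place true ∘ coord) ∘ s := funext fun l => hpt _
      have e₂ : pairTuple a b ∘ s =
          d ∘ pairTuple (place false ∘ coord) (place true ∘ coord) ∘ s :=
        funext fun l => (hcoord _).symm
      rw [e₁, e₂]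
      exact PairType.freeRel_relabel_iff hirr hasymm hvw R _

end HereditaryClass

/-! ### Closed walks and topological orderings -/

/-- The digraph `D` has a closed walk of length `m`, traversed periodically. -/
def HasClosedWalk {V : Type} (D : V → V → Prop) (m : ℕ) : Prop :=
  ∃ x : ℕ → V, (∀ i, D (x i) (x (i + 1))) ∧ ∀ i, x (i + m) = x i

section ClosedWalk

variable {V : Type} {D : V → V → Prop}

theorem HasClosedWalk.of_segment {m : ℕ} (hm : 0 < m) (x : ℕ → V)
    (hx : ∀ i < m, D (x i) (x (i + 1))) (h0 : x m = x 0) : HasClosedWalk D m := by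
  refine ⟨fun i => x (i % m), fun i => ?_, fun i => by simp⟩
  have hlt := Nat.mod_lt i hm
  have h := hx _ hlt
  change D (x (i % m)) (x ((i + 1) % m))
  rcases Nat.lt_or_ge (i % m + 1) m with h' | h'
  · have e : (i + 1) % m = i % m + 1 := by rw [← Nat.mod_add_mod, Nat.mod_eq_of_lt h']
    rwa [e]
  · have h'' : i % m + 1 = m := by omega
    have e : (i + 1) % m = 0 := by rw [← Nat.mod_add_mod, h'', Nat.mod_self]
    rw [h'', h0] at h
    rwa [e]

theorem HasClosedWalk.map {W : Type} {E : W → W → Prop} {m : ℕ} (h : HasClosedWalk D m)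
    (φ : V → W) (hφ : ∀ v w, D v w → E (φ v) (φ w)) : HasClosedWalk E m := by
  obtain ⟨x, hx, hp⟩ := h
  exact ⟨φ ∘ x, fun i => hφ _ _ (hx i), fun i => congrArg φ (hp i)⟩

/-- A closed walk on at most `N` vertices yields one of length at most `N`. -/
theorem HasClosedWalk.exists_le_card [Finite V] {N m : ℕ} (hN : Nat.card V ≤ N)
    (h : HasClosedWalk D m) : ∃ l, 0 < l ∧ l ≤ N ∧ HasClosedWalk D l := by
  obtain ⟨x, hx, -⟩ := h
  obtain ⟨i, j, hij, h⟩ : ∃ i j : Fin (N + 1), i < j ∧ x i = x j := by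
    have : ¬ Function.Injective fun i : Fin (N + 1) => x i := fun hinj => by
      have := Nat.card_le_card_of_injective _ hinj
      simp only [Nat.card_eq_fintype_card, Fintype.card_fin] at this
      omega
    simp only [Function.Injective, not_forall] at this
    obtain ⟨i, j, h, hne⟩ := this
    rcases lt_or_gt_of_ne hne with hij | hij
    · exact ⟨i, j, hij, h⟩
    · exact ⟨j, i, hij, h.symm⟩
  have hij' : (i : ℕ) < j := hij
  have hj := j.2
  refine ⟨j - i, by omega, by omega,
    .of_segment (by omega) (fun t => x (i + t)) (fun t _ => hx _) ?_⟩
  rw [show (i : ℕ) + (j - i) = j by omega]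
  exact h.symm

theorem HasClosedWalk.of_transGen {v : V} (h : Relation.TransGen D v v) :
    ∃ m, 0 < m ∧ HasClosedWalk D m := by
  have key : ∀ w, Relation.TransGen D v w →
      ∃ m, 0 < m ∧ ∃ x : ℕ → V, x 0 = v ∧ x m = w ∧ ∀ i < m, D (x i) (x (i + 1)) := by
    intro w h
    induction h with
    | single h =>
      rename_i w
      refine ⟨1, one_pos, fun i => if i = 0 then v else w, by simp, by simp, fun i hi => ?_⟩
      obtain rfl : i = 0 := by omega
      simpa using h
    | tail _ h ih =>
      rename_i u w _
      obtain ⟨m, hm, x, hx0, hxm, hx⟩ := ih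
      refine ⟨m + 1, m.succ_pos, fun i => if i ≤ m then x i else w, by simp [hx0], by simp,
        fun i hi => ?_⟩
      rcases Nat.lt_or_ge i m with h' | h'
      · simpa [h'.le, Nat.succ_le_of_lt h'] using hx i h'
      · obtain rfl : i = m := by omega
        simpa [hxm] using h
  obtain ⟨m, hm, x, hx0, hxm, hx⟩ := key v h
  exact ⟨m, hm, .of_segment hm x hx (hxm.trans hx0.symm)⟩

/-- A finite digraph without short closed walks has a topological ordering. -/
theorem exists_topological_order [Finite V] {N : ℕ} (hN : Nat.card V ≤ N)
    (hD : ∀ l, 0 < l → l ≤ N → ¬ HasClosedWalk D l) :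
    ∃ ρ : V → ℕ, Function.Injective ρ ∧ ∀ u v, D u v → ρ u < ρ v := by
  have hirr : ∀ v, ¬ Relation.TransGen D v v := fun v h => by
    obtain ⟨m, -, hm⟩ := HasClosedWalk.of_transGen h
    obtain ⟨l, hl, hlN, h⟩ := hm.exists_le_card hN
    exact hD l hl hlN h
  have : IsPartialOrder V (Relation.ReflTransGen D) :=
    { refl := fun _ => .refl
      trans := fun _ _ _ => .trans
      antisymm := fun u v huv hvu => by
        rcases Relation.reflTransGen_iff_eq_or_transGen.1 huv with h | h
        · exact h.symm
        · exact (hirr _ (h.trans_left hvu)).elim }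
  obtain ⟨s, hs, hle⟩ := extend_partialOrder (Relation.ReflTransGen D)
  -- The rank is the number of predecessors in a linear extension `s` of reachability.
  have hlt : ∀ u v, s u v → u ≠ v → {w | s w u}.ncard < {w | s w v}.ncard := by
    intro u v huv hne
    refine Set.ncard_lt_ncard ⟨fun w hw => hs.trans _ _ _ hw huv, fun h => hne ?_⟩
    exact hs.antisymm _ _ huv (h (hs.refl v))
  refine ⟨fun v => {w | s w v}.ncard, fun u v huv => ?_, fun u v huv => hlt u v ?_ ?_⟩
  · by_contra hne
    rcases hs.total u v with h | h
    · exact (hlt _ _ h hne).ne huv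
    · exact (hlt _ _ h (Ne.symm hne)).ne huv.symm
  · exact hle _ _ (.single huv)
  · rintro rfl
    exact hirr _ (.single huv)

end ClosedWalk

/-! ### Local tests for membership of free structures -/

namespace HereditaryClass

variable {L : FirstOrder.Language.{u, v}} [L.IsRelational]

/-- Whether a free structure belongs to the class depends only on small sets of vertices. -/
theorem contains_free_of_restrict {F : Set (CategoryTheory.Bundled.{0} L.Structure)}
    (hF : ∀ B ∈ F, Finite B) {N : ℕ} (hN : ∀ B ∈ F, Nat.card B < N) {C T : Type}
    (P : PairType L C T) {V : Type} [Nonempty V] (D : V → V → Prop)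
    (h : ∀ V₀ : Set V, V₀.Finite → V₀.Nonempty → V₀.ncard ≤ N →
      (forb F).Contains (P.Free fun x y : V₀ => D x y)) : (forb F).Contains (P.Free D) := by
  rw [contains_forb_iff hF]
  rintro B hB ⟨f, hf⟩
  have := hF B hB
  obtain ⟨v₀⟩ := ‹Nonempty V›
  let vert : C ⊕ V × T → V := Sum.elim (fun _ => v₀) Prod.fst
  -- The extra vertex `v₀` keeps the set nonempty and accounts for the strict bound `Nat.card B <
  -- N`.
  let V₀ : Set V := insert v₀ (Set.range fun b => vert (f b))
  have hcard : V₀.ncard ≤ N := by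
    refine (Set.ncard_insert_le _ _).trans ?_
    have h₁ : (Set.range fun b => vert (f b)).ncard ≤ Nat.card B := by
      rw [← Set.image_univ, ← Set.ncard_univ]
      exact Set.ncard_image_le
    have := hN B hB
    omega
  have hV₀ : V₀.Finite := (Set.finite_range _).insert _
  have h₁ := h V₀ hV₀ ⟨v₀, Set.mem_insert _ _⟩ hcard
  rw [contains_forb_iff hF] at h₁
  have hlift : ∀ b, ∃ x : C ⊕ V₀ × T, relabel Subtype.val x = f b := by
    intro b
    rcases hfb : f b with c | ⟨v, t⟩
    · exact ⟨Sum.inl c, rfl⟩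
    · exact ⟨Sum.inr (⟨v, Set.mem_insert_of_mem _ ⟨b, by simp only [hfb]; rfl⟩⟩, t), rfl⟩
  choose f' hf' using hlift
  have : Nonempty V₀ := ⟨⟨v₀, Set.mem_insert _ _⟩⟩
  refine h₁ B hB ⟨homOfRel (N := P.Free _) f' ?_, fun b b' hbb => hf ?_⟩
  · intro r R x hx
    refine (PairType.freeRel_map_iff (D := fun x y : V₀ => D x y) (E := D) Subtype.val
      Subtype.val_injective fun _ _ => Iff.rfl).1 ?_
    have : relabel Subtype.val ∘ f' ∘ x = f ∘ x := funext fun l => hf' (x l)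
    exact this ▸ f.map_rel R x hx
  · rw [← hf', ← hf']
    exact congrArg _ hbb

/-- Free structures along digraphs without short closed walks belong to the class. -/
theorem contains_free_of_no_closedWalk {F : Set (CategoryTheory.Bundled.{0} L.Structure)}
    (hF : ∀ B ∈ F, Finite B) {N : ℕ} (hN : ∀ B ∈ F, Nat.card B < N) {C T : Type}
    {P : PairType L C T} (hP : (forb F).Contains (P.Free fun i j : ℕ => i < j)) {V : Type}
    [Nonempty V] {D : V → V → Prop} (hD : ∀ l, 0 < l → l ≤ N → ¬ HasClosedWalk D l) :
    (forb F).Contains (P.Free D) := by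
  refine contains_free_of_restrict hF hN P D fun V₀ hV₀ _ hcard => ?_
  have := hV₀.to_subtype
  obtain ⟨ρ, hρ, hρD⟩ := exists_topological_order (D := fun x y : V₀ => D x y) hcard
    fun l hl hlN h => hD l hl hlN (h.map Subtype.val fun _ _ => id)
  refine hP.of_weaklyEmbeds hF ⟨homOfRel (M := P.Free _) (N := P.Free _) (relabel ρ) ?_,
    relabel_injective hρ⟩
  exact fun r R z hz => PairType.FreeRel.map hz ρ fun v w _ _ => hρD v w

end HereditaryClass

/-! ### Disjoint copies, unrolling and points on the circle -/

theorem TupleEquiv.comp {L : FirstOrder.Language.{u, v}} {M N : Type} [L.Structure M]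
    [L.Structure N] {ι κ : Type} {x : ι → M} {y : ι → N} (h : TupleEquiv L x y) (σ : κ → ι) :
    TupleEquiv L (x ∘ σ) (y ∘ σ) :=
  ⟨fun i j => h.1 (σ i) (σ j), fun n R s => h.2 n R (σ ∘ s)⟩

theorem TupleEquiv.symm {L : FirstOrder.Language.{u, v}} {M N : Type} [L.Structure M]
    [L.Structure N] {ι : Type} {x : ι → M} {y : ι → N} (h : TupleEquiv L x y) :
    TupleEquiv L y x :=
  ⟨fun i j => (h.1 i j).symm, fun n R s => (h.2 n R s).symm⟩

theorem TupleEquiv.trans {L : FirstOrder.Language.{u, v}} {M N K : Type} [L.Structure M]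
    [L.Structure N] [L.Structure K] {ι : Type} {x : ι → M} {y : ι → N} {z : ι → K}
    (h : TupleEquiv L x y) (h' : TupleEquiv L y z) : TupleEquiv L x z :=
  ⟨fun i j => (h.1 i j).trans (h'.1 i j), fun n R s => (h.2 n R s).trans (h'.2 n R s)⟩

/-- From sufficiently many disjoint copies at every index, one can choose copies which are disjoint
for different indices. -/
theorem exists_disjoint_copies {V T Y : Type} [Finite V] [Finite T] {Q : ℕ}
    (hQ : Nat.card V * Nat.card T < Q) (e : V → Fin Q → T → Y)
    (he : ∀ v a a' t t', e v a t = e v a' t' → a = a' ∧ t = t') :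
    ∃ a : V → Fin Q, ∀ v w t t', e v (a v) t = e w (a w) t' → v = w ∧ t = t' := by
  classical
  have := Fintype.ofFinite V
  suffices h : ∀ s : Finset V, ∃ a : V → Fin Q, ∀ v ∈ s, ∀ w ∈ s, ∀ t t',
      e v (a v) t = e w (a w) t' → v = w ∧ t = t' by
    obtain ⟨a, ha⟩ := h Finset.univ
    exact ⟨a, fun v w => ha v (Finset.mem_univ _) w (Finset.mem_univ _)⟩
  intro s
  induction s using Finset.induction_on with
  | empty => exact ⟨fun _ => ⟨0, by omega⟩, by simp⟩
  | insert v s hv ih =>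
    obtain ⟨a, ha⟩ := ih
    -- Copies at `v` are disjoint, so if each met an earlier choice, the meeting points would inject
    -- `Fin Q` into `V × T`.
    have : ∃ α : Fin Q, ∀ w ∈ s, ∀ t t', e v α t ≠ e w (a w) t' := by
      by_contra! hbad
      choose w hw t t' h using hbad
      have hinj : Function.Injective fun α => (w α, t' α) := by
        intro α β hαβ
        simp only [Prod.mk.injEq] at hαβ
        refine (he v α β (t α) (t β) ?_).1
        rw [h, h, hαβ.1, hαβ.2]
      have := Nat.card_le_card_of_injective _ hinj
      rw [Nat.card_prod, Nat.card_eq_fintype_card, Fintype.card_fin] at this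
      omega
    obtain ⟨α, hα⟩ := this
    have hne : ∀ w ∈ s, w ≠ v := fun w hw h => hv (h ▸ hw)
    refine ⟨Function.update a v α, fun w hw w' hw' t t' h => ?_⟩
    rcases Finset.mem_insert.1 hw with hwv | hws <;>
      rcases Finset.mem_insert.1 hw' with hwv' | hws'
    · exact ⟨hwv.trans hwv'.symm, (he v _ _ _ _ (by rwa [hwv, hwv'] at h)).2⟩
    · rw [hwv, Function.update_self, Function.update_of_ne (hne _ hws')] at h
      exact (hα _ hws' _ _ h).elim
    · rw [hwv', Function.update_self, Function.update_of_ne (hne _ hws)] at h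
      exact (hα _ hws _ _ h.symm).elim
    · rw [Function.update_of_ne (hne _ hws'), Function.update_of_ne (hne _ hws)] at h
      exact ha _ hws _ hws' _ _ h

/-- Unroll `D` over `U`: every vertex is replaced by a sequence of copies, and arrows inside `U`
increase the index. -/
def unroll {V : Type} (D : V → V → Prop) (U : Set V) (p q : V × ℕ) : Prop :=
  D p.1 q.1 ∧ (p.1 ∈ U → q.1 ∈ U → p.2 < q.2)

/-- The point of the circle at the angle `2πj/m`. -/
noncomputable def circlePoint (m j : ℕ) : Circle := Circle.exp (2 * Real.pi / m * j)

theorem withinCCW_circlePoint {n m : ℕ} (hn : 0 < n) (hnm : n ≤ m) (j : ℕ) :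
    WithinCCW n (circlePoint m j) (circlePoint m (j + 1)) := by
  have hn' : (0 : ℝ) < n := Nat.cast_pos.2 hn
  have hm' : (0 : ℝ) < m := Nat.cast_pos.2 (hn.trans_le hnm)
  refine ⟨2 * Real.pi / m, by positivity, ?_, ?_⟩
  · gcongr
  · rw [circlePoint, circlePoint, ← Circle.exp_add]
    push_cast
    congr 1
    ring

theorem circlePoint_eq_of_modEq {m : ℕ} (hm : 0 < m) {i j : ℕ} (h : i ≡ j [MOD m]) :
    circlePoint m i = circlePoint m j := by
  have key : ∀ i, circlePoint m i = circlePoint m (i % m) := fun i => by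
    have hm' : (m : ℝ) ≠ 0 := Nat.cast_ne_zero.2 hm.ne'
    have e : 2 * Real.pi / m * (i : ℝ) =
        2 * Real.pi / m * ((i % m : ℕ) : ℝ) + (i / m : ℕ) * (2 * Real.pi) := by
      have : (i : ℝ) = (i % m : ℕ) + m * (i / m : ℕ) := by
        exact_mod_cast (Nat.mod_add_div i m).symm
      rw [this]
      field_simp
    rw [circlePoint, circlePoint, e, Circle.exp_add]
    have h2 : Circle.exp ((i / m : ℕ) * (2 * Real.pi)) = 1 :=
      Circle.exp_eq_one.2 ⟨(i / m : ℕ), by push_cast; rfl⟩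
    rw [h2, mul_one]
  rw [key i, key j, h]

/-! ### Rolling up along the circle -/

namespace HereditaryClass

variable {L : FirstOrder.Language.{u, v}} [L.IsRelational]

/-- The property `NSOP_r` applied to a sequence of finite tuples. -/
theorem NSOP.exists_circle {H : HereditaryClass L} {r : ℝ} (h : H.NSOP r) {X : Type}
    [L.Structure X] (hX : H.Contains X) {ι : Type} [Finite ι] {A : ℕ → ι → X}
    (hA : ∀ i j, i < j → TupleEquiv L (Sum.elim (A i) (A j)) (Sum.elim (A 0) (A 1))) :
    ∃ (Y : Type) (_ : L.Structure Y), H.Contains Y ∧ ∃ B : Circle → ι → Y, ∀ θ ψ,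
      WithinCCW r θ ψ → TupleEquiv L (Sum.elim (B θ) (B ψ)) (Sum.elim (A 0) (A 1)) := by
  obtain ⟨k, ⟨e⟩⟩ := Finite.exists_equiv_fin ι
  let S : L.Substructure X := ⟨Set.range (Sum.elim (A 0) (A 1)), fun F => isEmptyElim F⟩
  let x : ι ⊕ ι → S := fun i => ⟨Sum.elim (A 0) (A 1) i, i, rfl⟩
  have hx : TupleEquiv L (Sum.elim (A 0) (A 1)) x := 
    ⟨fun i j => (Subtype.ext_iff (a1 := x i) (a2 := x j)).symm, fun n R s => Iff.rfl⟩
  let a : Fin k → S := fun p => x (Sum.inl (e.symm p))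
  let b : Fin k → S := fun p => x (Sum.inr (e.symm p))
  have hab : pairTuple a b = x ∘ Sum.map e.symm e.symm := by
    funext p; rcases p with p | p <;> rfl
  have hsurj : Function.Surjective (pairTuple a b) := by
    rintro ⟨_, p, rfl⟩
    rw [hab]
    refine ⟨Sum.map e e p, ?_⟩
    rcases p with p | p <;> simp [x]
  have hseq : H.HasSequence a b := by
    refine ⟨X, _, hX, fun i p => A i (e.symm p), fun i j hij => ?_⟩
    have e₁ : pairTuple (fun p => A i (e.symm p)) (fun p => A j (e.symm p)) =
        Sum.elim (A i) (A j) ∘ Sum.map e.symm e.symm := by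
      funext p; rcases p with p | p <;> rfl
    rw [e₁, hab]
    exact ((hA i j hij).trans hx).comp _
  obtain ⟨Y, _, hY, B, hB⟩ := h S k a b hsurj hseq
  refine ⟨Y, _, hY, fun θ i => B θ (e i), fun θ ψ hθ => ?_⟩
  have h₁ := (hB θ ψ hθ).comp (Sum.map e e)
  have e₁ : pairTuple (B θ) (B ψ) ∘ Sum.map e e =
      Sum.elim (fun i => B θ (e i)) (fun i => B ψ (e i)) := by
    funext p; rcases p with p | p <;> rfl
  have e₂ : pairTuple a b ∘ Sum.map e e = x := by
    rw [hab]
    funext p; rcases p with p | p <;> simp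
  rw [e₁, e₂] at h₁
  exact h₁.trans hx.symm

/-- If `D` restricted to `U` maps homomorphically to the directed `m`-cycle and the class has the
property `NSOP_n` for some `n ≤ m`, then membership of the free structure along `D` follows from
that of the free structure along the unrolling of `D` over `U`. -/
theorem NSOP.contains_free_of_unroll {F : Set (CategoryTheory.Bundled.{0} L.Structure)}
    (hF : ∀ B ∈ F, Finite B) {n m : ℕ} (hn : 0 < n) (hnm : n ≤ m) (hN : (forb F).NSOP n)
    {C T : Type} [Finite C] [Finite T] {P : PairType L C T} {V : Type} [Finite V] [Nonempty V]
    {D : V → V → Prop} (U : Set V) (κ : V → ℕ)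
    (hκ : ∀ u ∈ U, ∀ u' ∈ U, D u u' → κ u' ≡ κ u + 1 [MOD m])
    (h : (forb F).Contains (P.Free (unroll D U))) : (forb F).Contains (P.Free D) := by
  classical
  let Q := Nat.card V * Nat.card T + 1
  -- Over `U`, the `i`-th tuple occupies the `i`-th block of `Q` consecutive levels; elsewhere its
  -- levels do not depend on `i`.
  let lev : ℕ → V → Fin Q → ℕ := fun i v α => if v ∈ U then Q * i + α else α
  let A : ℕ → C ⊕ V × Fin Q × T → C ⊕ (V × ℕ) × T := fun i =>
    Sum.elim Sum.inl fun x => Sum.inr ((x.1, lev i x.1 x.2.1), x.2.2)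
  have hA : ∀ i j, i < j → TupleEquiv L (M := P.Free (unroll D U)) (N := P.Free (unroll D U))
      (Sum.elim (A i) (A j)) (Sum.elim (A 0) (A 1)) := by
    intro i j hij
    -- An increasing map carrying blocks 0 and 1 to blocks `i` and `j`; applied over `U` only, it
    -- preserves and reflects arrows of the unrolling.
    let ρ : ℕ → ℕ := fun l => if l < Q then Q * i + l else Q * j + (l - Q)
    have hρ : StrictMono ρ := by
      intro l l' hl
      have hQ : Q * (i + 1) ≤ Q * j := Nat.mul_le_mul_left _ hij
      rw [mul_add, mul_one] at hQ
      simp only [ρ]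
      split_ifs <;> omega
    let φ : V × ℕ → V × ℕ := fun p => (p.1, if p.1 ∈ U then ρ p.2 else p.2)
    have hφ : Function.Injective φ := by
      rintro ⟨v, l⟩ ⟨v', l'⟩ heq
      simp only [φ, Prod.mk.injEq] at heq
      obtain ⟨rfl, heq⟩ := heq
      split_ifs at heq
      · rw [hρ.injective heq]
      · rw [heq]
    have hD : ∀ p q, unroll D U p q ↔ unroll D U (φ p) (φ q) := by
      rintro ⟨v, l⟩ ⟨v', l'⟩
      refine and_congr_right fun _ => forall_congr' fun hv => forall_congr' fun hv' => ?_
      change v ∈ U at hv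
      change v' ∈ U at hv'
      simp only [φ, hv, hv', if_true]
      exact hρ.lt_iff_lt.symm
    have key : ∀ x, Sum.elim (A i) (A j) x = relabel φ (Sum.elim (A 0) (A 1) x) := by
      rintro ((c | ⟨v, α, t⟩) | (c | ⟨v, α, t⟩))
      · rfl
      · change (Sum.inr _ : C ⊕ (V × ℕ) × T) = Sum.inr _
        have hα := α.2
        by_cases hv : v ∈ U <;> simp [hv, lev, φ, ρ, hα]
      · rfl
      · change (Sum.inr _ : C ⊕ (V × ℕ) × T) = Sum.inr _
        by_cases hv : v ∈ U <;> simp [hv, lev, φ, ρ]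
    have hinj : ∀ x y, Sum.elim (A i) (A j) x = Sum.elim (A i) (A j) y ↔
        Sum.elim (A 0) (A 1) x = Sum.elim (A 0) (A 1) y := fun x y => by
      rw [key, key]
      exact (relabel_injective hφ).eq_iff
    refine ⟨hinj, fun r R s => ?_⟩
    have e : Sum.elim (A i) (A j) ∘ s = relabel φ ∘ Sum.elim (A 0) (A 1) ∘ s :=
      funext fun l => key _
    have hrel := PairType.freeRel_map_iff (P := P) (R := R) (z := Sum.elim (A 0) (A 1) ∘ s) φ hφ hD
    rw [← e] at hrel
    exact hrel
  obtain ⟨Y, _, hY, B, hB⟩ := hN.exists_circle (X := P.Free (unroll D U)) h hA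
  have hstep := fun j => hB _ _ (withinCCW_circlePoint hn hnm j)
  have hBinj : ∀ j, Function.Injective (B (circlePoint m j)) := by
    intro j x y hxy
    have hA0 : A 0 x = A 0 y := ((hstep j).1 (Sum.inl x) (Sum.inl y)).1 hxy
    rcases x with c | ⟨v, α, t⟩ <;> rcases y with c' | ⟨v', α', t'⟩
    · rw [Sum.inl_injective hA0]
    · exact (Sum.inl_ne_inr hA0).elim
    · exact (Sum.inr_ne_inl hA0).elim
    · have := Sum.inr_injective hA0
      simp only [Prod.mk.injEq, lev] at this
      obtain ⟨⟨rfl, h₂⟩, rfl⟩ := this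
      split_ifs at h₂
      · rw [Fin.ext (by omega : (α : ℕ) = α')]
      · rw [Fin.ext h₂]
  have hBrel : ∀ j (r : ℕ) (R : L.Relations r) (s : Fin r → C ⊕ V × Fin Q × T),
      P.FreeRel (unroll D U) R (A 0 ∘ s) →
      FirstOrder.Language.Structure.RelMap R (B (circlePoint m j) ∘ s) := fun j r R s hs =>
    ((hstep j).2 r R (Sum.inl ∘ s)).2 hs
  have hconst : ∀ x, A 0 x = A 1 x → ∀ i j, B (circlePoint m i) x = B (circlePoint m j) x := by
    intro x hx
    have h0 : ∀ j, B (circlePoint m j) x = B (circlePoint m 0) x := by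
      intro j
      induction j with
      | zero => rfl
      | succ j ih => exact (((hstep j).1 (Sum.inl x) (Sum.inr x)).2 hx).symm.trans ih
    exact fun i j => (h0 i).trans (h0 j).symm
  have hconst_inl : ∀ c i j, B (circlePoint m i) (Sum.inl c) = B (circlePoint m j) (Sum.inl c) :=
    fun c => hconst _ rfl
  have hconst_inr : ∀ v, v ∉ U → ∀ α t i j, B (circlePoint m i) (Sum.inr (v, α, t)) =
      B (circlePoint m j) (Sum.inr (v, α, t)) := fun v hv α t => hconst _ (by simp [A, lev, hv])
  -- Nothing is known about equalities between tuples at distant points of the circle, hence the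
  -- choice among `Q` copies.
  obtain ⟨a, ha⟩ := exists_disjoint_copies (Nat.lt_succ_self (Nat.card V * Nat.card T))
    (fun v (α : Fin Q) t => B (circlePoint m (κ v)) (Sum.inr (v, α, t)))
    fun v α α' t t' heq => by simpa using hBinj _ heq
  let f : C ⊕ V × T → Y := Sum.elim (fun c => B (circlePoint m 0) (Sum.inl c)) fun x =>
    B (circlePoint m (κ x.1)) (Sum.inr (x.1, a x.1, x.2))
  refine hY.of_weaklyEmbeds hF ⟨homOfRel (M := P.Free D) f ?_, ?_⟩
  · rintro r R z (⟨v, y, rfl, hy⟩ | ⟨g, y, hD, hs, rfl, hy⟩)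
    · have e₁ : f ∘ place v ∘ y =
          B (circlePoint m (κ v)) ∘ Sum.map id (fun t => (v, a v, t)) ∘ y := by
        funext l
        rcases hyl : y l with c | t <;> simp [hyl, f]
        exact hconst_inl _ _ _
      have e₂ : A 0 ∘ Sum.map id (fun t => (v, a v, t)) ∘ y = place (v, lev 0 v (a v)) ∘ y := by
        funext l
        rcases hyl : y l with c | t <;> simp [hyl, A]
      have hfree : P.FreeRel (unroll D U) R (A 0 ∘ Sum.map id (fun t => (v, a v, t)) ∘ y) :=
        e₂ ▸ Or.inl ⟨_, y, rfl, hy⟩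
      have key := hBrel (κ v) r R _ hfree
      rw [← e₁] at key
      exact key
    -- An arrow inside `U` advances `κ` by one step, so it is read from neighbouring points.
    -- Otherwise an end lies outside `U`, where the tuples are constant around the points used, so a
    -- single point suffices.
    · by_cases hU : g false ∈ U ∧ g true ∈ U
      · have hw : WithinCCW n (circlePoint m (κ (g false))) (circlePoint m (κ (g true))) := by
          rw [circlePoint_eq_of_modEq (hn.trans_le hnm) (hκ _ hU.1 _ hU.2 hD)]
          exact withinCCW_circlePoint hn hnm _
        let σ : C ⊕ Bool × T → (C ⊕ V × Fin Q × T) ⊕ (C ⊕ V × Fin Q × T) :=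
          Sum.elim (fun c => Sum.inl (Sum.inl c)) fun x => if x.1
            then Sum.inr (Sum.inr (g true, a (g true), x.2))
            else Sum.inl (Sum.inr (g false, a (g false), x.2))
        let g' : Bool → V × ℕ := fun b => if b
          then (g true, lev 1 (g true) (a (g true)))
          else (g false, lev 0 (g false) (a (g false)))
        have e₁ : f ∘ relabel g ∘ y = Sum.elim (B (circlePoint m (κ (g false))))
            (B (circlePoint m (κ (g true)))) ∘ σ ∘ y := by
          funext l
          rcases hyl : y l with c | ⟨_ | _, t⟩ <;> simp [hyl, f, σ]
          exact hconst_inl _ _ _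
        have e₂ : Sum.elim (A 0) (A 1) ∘ σ ∘ y = relabel g' ∘ y := by
          funext l
          rcases hyl : y l with c | ⟨_ | _, t⟩ <;> simp [hyl, A, σ, g']
        have hlt : lev 0 (g false) (a (g false)) < lev 1 (g true) (a (g true)) := by
          have := (a (g false)).2
          simp only [lev, hU.1, hU.2, if_true]
          omega
        have hfree : P.FreeRel (unroll D U) R (Sum.elim (A 0) (A 1) ∘ σ ∘ y) :=
          e₂ ▸ Or.inr ⟨g', y, ⟨hD, fun _ _ => hlt⟩, hs, rfl, hy⟩
        have key := ((hB _ _ hw).2 r R (σ ∘ y)).2 hfree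
        rw [← e₁] at key
        exact key
      · obtain ⟨j, hj⟩ : ∃ j, ∀ b, g b ∈ U → κ (g b) = j := by
          by_cases h₀ : g false ∈ U
          · refine ⟨κ (g false), ?_⟩
            rintro (_ | _) hb
            · rfl
            · exact (hU ⟨h₀, hb⟩).elim
          · refine ⟨κ (g true), ?_⟩
            rintro (_ | _) hb
            · exact (h₀ hb).elim
            · rfl
        let σ : C ⊕ Bool × T → C ⊕ V × Fin Q × T :=
          Sum.map id fun x => (g x.1, a (g x.1), x.2)
        have e₁ : f ∘ relabel g ∘ y = B (circlePoint m j) ∘ σ ∘ y := by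
          funext l
          rcases hyl : y l with c | ⟨b, t⟩ <;> simp [hyl, f, σ]
          · exact hconst_inl _ _ _
          · by_cases hb : g b ∈ U
            · rw [hj b hb]
            · exact hconst_inr _ hb _ _ _ _
        have e₂ : A 0 ∘ σ ∘ y = relabel (fun b => (g b, lev 0 (g b) (a (g b)))) ∘ y := by
          funext l
          rcases hyl : y l with c | ⟨b, t⟩ <;> simp [hyl, A, σ]
        have key := hBrel j r R (σ ∘ y)
          (e₂ ▸ Or.inr ⟨_, y, ⟨hD, fun h₁ h₂ => (hU ⟨h₁, h₂⟩).elim⟩, hs, rfl, hy⟩)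
        rw [← e₁] at key
        exact key
  · change Function.Injective f
    rintro (c | ⟨v, t⟩) (c' | ⟨v', t'⟩) heq
    · exact congrArg Sum.inl (Sum.inl_injective (hBinj _ heq))
    · have h' : B (circlePoint m 0) (Sum.inl c) = B (circlePoint m (κ v')) _ := heq
      rw [hconst_inl c 0 (κ v')] at h'
      exact (Sum.inl_ne_inr (hBinj _ h')).elim
    · have h' : B (circlePoint m (κ v)) _ = B (circlePoint m 0) (Sum.inl c') := heq
      rw [hconst_inl c' 0 (κ v)] at h'
      exact (Sum.inr_ne_inl (hBinj _ h')).elim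
    · obtain ⟨rfl, rfl⟩ := ha v v' t t' heq
      rfl

end HereditaryClass

/-! ### Shortest closed walks, and walks around the circle -/

/-- The vertices of a shortest closed walk map homomorphically to a directed cycle. -/
theorem HasClosedWalk.exists_cycle_map {V : Type} {D : V → V → Prop} {m : ℕ} (hm : 0 < m)
    (hD : ∀ l, 0 < l → l < m → ¬ HasClosedWalk D l) {x : ℕ → V}
    (hx : ∀ i, D (x i) (x (i + 1))) (hp : ∀ i, x (i + m) = x i) :
    ∃ κ : V → ℕ, ∀ u ∈ Set.range x, ∀ u' ∈ Set.range x, D u u' → κ u' ≡ κ u + 1 [MOD m] := by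
  classical
  have key : ∀ s t, D (x s) (x t) → t ≡ s + 1 [MOD m] := by
    intro s t hst
    -- This is `s - t` modulo `m`. Following the walk from `t` for `d` steps and returning by the
    -- arrow closes up after `d + 1 ≤ m` steps; minimality gives equality.
    let d := (s + (m - 1) * t) % m
    have hd : d < m := Nat.mod_lt _ hm
    have hmod : t + d ≡ s [MOD m] := by
      have h₁ : t + d ≡ t + (s + (m - 1) * t) [MOD m] := (Nat.mod_modEq _ _).add_left t
      have h₂ : t + (s + (m - 1) * t) = s + m * t := by
        obtain ⟨m, rfl⟩ : ∃ m', m = m' + 1 := ⟨m - 1, by omega⟩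
        simp only [Nat.add_sub_cancel]
        ring
      rw [h₂] at h₁
      exact h₁.trans (by simp [Nat.ModEq])
    have hxs : x (t + d) = x s := by
      have hper : Function.Periodic x m := hp
      rw [← hper.map_mod_nat (t + d), hmod, hper.map_mod_nat]
    have hwalk : HasClosedWalk D (d + 1) := by
      refine .of_segment d.succ_pos (fun k => if k ≤ d then x (t + k) else x t) (fun i hi => ?_)
        (by simp)
      rcases Nat.lt_or_ge i d with h' | h'
      · simpa [h'.le, Nat.succ_le_of_lt h', add_assoc] using hx (t + i)
      · obtain rfl : i = d := by omega
        simpa [hxs] using hst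
    have hdm : d + 1 = m := by
      by_contra hne
      exact hD _ d.succ_pos (by omega) hwalk
    have h₃ := hmod.add_right 1
    rw [add_assoc, hdm] at h₃
    exact (by simp [Nat.ModEq] : t ≡ t + m [MOD m]).trans h₃
  refine ⟨fun u => if h : ∃ s, x s = u then h.choose else 0, ?_⟩
  rintro u hu u' hu' huu
  have hu₁ : ∃ s, x s = u := hu
  have hu₁' : ∃ s, x s = u' := hu'
  simp only [hu₁, hu₁', dif_pos]
  refine key _ _ ?_
  rwa [hu₁.choose_spec, hu₁'.choose_spec]

/-- A closed walk of `l` steps of at most `2π/r` around the circle has `r ≤ l`. -/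
theorem HasClosedWalk.le_of_withinCCW {r : ℝ} (hr : 0 < r) {l : ℕ} (hl : 0 < l)
    (h : HasClosedWalk (WithinCCW r) l) : r ≤ l := by
  obtain ⟨x, hx, hp⟩ := h
  choose t ht0 ht hxt using hx
  have hsum : ∀ k, x k = Circle.exp (∑ i ∈ Finset.range k, t i) * x 0 := by
    intro k
    induction k with
    | zero => simp
    | succ k ih => rw [hxt, ih, Finset.sum_range_succ, add_comm, Circle.exp_add, mul_assoc]
  have hexp : Circle.exp (∑ i ∈ Finset.range l, t i) = 1 := by
    have h₁ := hsum l
    have h₂ := hp 0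
    rw [zero_add] at h₂
    rw [h₂] at h₁
    exact (right_eq_mul.1 h₁)
  obtain ⟨k, hk⟩ := Circle.exp_eq_one.1 hexp
  have hpos : 0 < ∑ i ∈ Finset.range l, t i :=
    Finset.sum_pos (fun i _ => ht0 i) (Finset.nonempty_range_iff.2 hl.ne')
  have hle : ∑ i ∈ Finset.range l, t i ≤ l * (2 * Real.pi / r) := by
    simpa using Finset.sum_le_sum fun i (_ : i ∈ Finset.range l) => ht i
  have hpi := Real.two_pi_pos
  have hk1 : (1 : ℝ) ≤ k := by
    rw [hk] at hpos
    have : (0 : ℝ) < k := pos_of_mul_pos_left hpos hpi.le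
    exact_mod_cast this
  have h₃ : 2 * Real.pi ≤ l * (2 * Real.pi / r) := by
    refine le_trans ?_ hle
    rw [hk]
    nlinarith
  rw [mul_div_assoc', le_div_iff₀ hr] at h₃
  nlinarith

/-! ### Downward induction on the length of closed walks -/

namespace HereditaryClass

variable {L : FirstOrder.Language.{u, v}} [L.IsRelational]

/-- Unroll all shortest closed walks of a finite digraph. -/
theorem NSOP.contains_free_of_longer_closedWalk
    {F : Set (CategoryTheory.Bundled.{0} L.Structure)}
    (hF : ∀ B ∈ F, Finite B) {N : ℕ} (hFN : ∀ B ∈ F, Nat.card B < N) {n m : ℕ} (hn : 0 < n)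
    (hnm : n ≤ m) (hN : (forb F).NSOP n) {C T : Type} [Finite C] [Finite T] {P : PairType L C T}
    (ih : ∀ (V : Type) [Nonempty V] (D : V → V → Prop),
      (∀ l, 0 < l → l < m + 1 → ¬ HasClosedWalk D l) → (forb F).Contains (P.Free D))
    {V : Type} [Finite V] [Nonempty V] {D : V → V → Prop}
    (hD : ∀ l, 0 < l → l < m → ¬ HasClosedWalk D l) : (forb F).Contains (P.Free D) := by
  classical
  have hm := hn.trans_le hnm
  let IsCycle : Set V → Prop := fun U =>
    ∃ κ : V → ℕ, ∀ u ∈ U, ∀ u' ∈ U, D u u' → κ u' ≡ κ u + 1 [MOD m]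
  -- Here `s` holds the cyclic sets still to be unrolled, and `V'` is the current partial unrolling
  -- over `V`; each cyclic set outside `s` has a level function increasing along its arrows.
  have key : ∀ s : Finset (Set V), (∀ U ∈ s, IsCycle U) →
      ∀ (V' : Type) [Nonempty V'] (D' : V' → V' → Prop) (π : V' → V),
      (∀ p q, D' p q → D (π p) (π q)) →
      (∀ U, IsCycle U → U ∉ s →
        ∃ lev : V' → ℕ, ∀ p q, D' p q → π p ∈ U → π q ∈ U → lev p < lev q) →
      (forb F).Contains (P.Free D') := by
    intro s
    induction s using Finset.induction_on with
    | empty =>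
      intro _ V' _ D' π hπ hlev
      -- A closed walk of length `m` would project to a shortest one, whose vertices form a cyclic
      -- set; its level would increase strictly around the walk.
      refine ih V' D' fun l hl hlm h => ?_
      rcases (Nat.lt_succ_iff.1 hlm).lt_or_eq with hlt | rfl
      · exact hD l hl hlt (h.map π hπ)
      · obtain ⟨x, hx, hp⟩ := h
        obtain ⟨lev, hlev⟩ := hlev _ (HasClosedWalk.exists_cycle_map hm hD (x := π ∘ x)
          (fun i => hπ _ _ (hx i)) fun i => congrArg π (hp i)) (Finset.notMem_empty _)
        have hmono : StrictMono (lev ∘ x) :=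
          strictMono_nat_of_lt_succ fun i => hlev _ _ (hx i) ⟨i, rfl⟩ ⟨i + 1, rfl⟩
        have := hmono (Nat.lt_add_of_pos_right (n := 0) hl)
        simp only [Function.comp_apply, hp, lt_self_iff_false] at this
    | insert U s _ ihs =>
      intro hs V' _ D' π hπ hlev
      obtain ⟨κ, hκ⟩ := hs U (Finset.mem_insert_self _ _)
      -- Earlier unrollings make `V'` infinite, whereas rolling up needs finitely many vertices.
      refine contains_free_of_restrict hF hFN P D' fun V₀ hV₀ hne _ => ?_
      have := hV₀.to_subtype
      have := hne.to_subtype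
      refine hN.contains_free_of_unroll hF hn hnm {v : V₀ | π v ∈ U} (fun v => κ (π v))
        (fun u hu u' hu' huu => hκ _ hu _ hu' (hπ _ _ huu)) ?_
      refine ihs (fun W hW => hs W (Finset.mem_insert_of_mem hW)) (V₀ × ℕ) _
        (fun p => π p.1) (fun p q h => hπ _ _ h.1) fun W hW hWs => ?_
      by_cases hWU : W = U
      · subst hWU
        exact ⟨Prod.snd, fun p q h => h.2⟩
      · obtain ⟨lev, hlev⟩ := hlev W hW (by simp [hWU, hWs])
        exact ⟨fun p => lev p.1, fun p q h => hlev _ _ h.1⟩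
  have := Fintype.ofFinite (Set V)
  exact key (Finset.univ.filter IsCycle) (fun U hU => (Finset.mem_filter.1 hU).2) V D id
    (fun _ _ => id) fun U hU hUs => (hUs (Finset.mem_filter.2 ⟨Finset.mem_univ _, hU⟩)).elim

/-- Under `NSOP_n`, the free structures along all digraphs without closed walks of length less than
`n` belong to the class. -/
theorem NSOP.contains_free {F : Set (CategoryTheory.Bundled.{0} L.Structure)}
    (hF : ∀ B ∈ F, Finite B) {N : ℕ} (hFN : ∀ B ∈ F, Nat.card B < N) {n : ℕ} (hn : 0 < n)
    (hN : (forb F).NSOP n) {C T : Type} [Finite C] [Finite T] {P : PairType L C T}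
    (hP : (forb F).Contains (P.Free fun i j : ℕ => i < j)) {V : Type} [Nonempty V]
    {D : V → V → Prop} (hD : ∀ l, 0 < l → l < n → ¬ HasClosedWalk D l) :
    (forb F).Contains (P.Free D) := by
  have key : ∀ d m, n ≤ m → N + 1 ≤ m + d → ∀ (V : Type) [Nonempty V] (D : V → V → Prop),
      (∀ l, 0 < l → l < m → ¬ HasClosedWalk D l) → (forb F).Contains (P.Free D) := by
    intro d
    induction d with
    | zero =>
      intro m _ hm V _ D hD
      exact contains_free_of_no_closedWalk hF hFN hP fun l hl hlN => hD l hl (by omega)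
    | succ d ih =>
      intro m hnm hm V _ D hD
      refine contains_free_of_restrict hF hFN P D fun V₀ hV₀ hne _ => ?_
      have := hV₀.to_subtype
      have := hne.to_subtype
      exact hN.contains_free_of_longer_closedWalk hF hFN hn hnm
        (ih (m + 1) (by omega) (by omega))
        fun l hl hlm h => hD l hl hlm (h.map Subtype.val fun _ _ => id)
  exact key (N + 1) n le_rfl (by omega) V D hD

/-- If the free structures along the circle belong to the class, it has the property `NSOP_r`. -/
theorem nsop_of_contains_free {F : Set (CategoryTheory.Bundled.{0} L.Structure)}
    (hF : ∀ B ∈ F, Finite B) {r : ℝ} (hr : 3 ≤ r)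
    (h : ∀ (C T : Type) [Finite C] [Finite T] (P : PairType L C T),
      (forb F).Contains (P.Free fun i j : ℕ => i < j) →
        (forb F).Contains (P.Free (WithinCCW r))) : (forb F).NSOP r := by
  intro M _ k a b _ hab
  obtain ⟨C, T, _, _, P, coord, hP, hcoord⟩ := hab.exists_pairType hF
  -- Since `r ≥ 3`, the circle digraph has no loops or 2-cycles, so its arrows realize the type
  -- exactly.
  have hwalk : ∀ l, 0 < l → l < 3 → ¬ HasClosedWalk (WithinCCW r) l := fun l hl hl3 hw => by
    have h₁ := hw.le_of_withinCCW (by linarith) hl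
    have h₂ : (l : ℝ) < 3 := by exact_mod_cast hl3
    linarith
  refine ⟨P.Free (WithinCCW r), inferInstance, h C T P hP, fun θ => place θ ∘ coord, ?_⟩
  refine hcoord Circle (WithinCCW r) (fun v hv => ?_) fun v w hvw hwv => ?_
  · exact hwalk 1 one_pos (by norm_num) ⟨fun _ => v, fun _ => hv, fun _ => rfl⟩
  · refine hwalk 2 two_pos (by norm_num)
      (.of_segment two_pos (fun i => if i = 1 then w else v) (fun i hi => ?_) (by simp))
    interval_cases i <;> simpa

end HereditaryClass

/-! ### Integrality of the rank -/

theorem theorem3p1 {L : FirstOrder.Language.{u, v}} [L.IsRelational] [Finite (Σ n, L.Relations n)]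
    (H : HereditaryClass L) (hH : H.DefinedByFiniteFamily) :
    (∃ n : ℕ, H.sopRank = (n : ENNReal)) ∧
      ∀ r : ℝ, 3 ≤ r → H.SOP r → H.SOP (⌈r⌉₊ : ℝ) := by
  obtain ⟨F, hFfin, hF, rfl⟩ := hH
  obtain ⟨N, hN⟩ : ∃ N, ∀ B ∈ F, Nat.card B < N := by
    obtain ⟨N, hN⟩ := (Set.Finite.image (fun B => Nat.card B.α) hFfin).bddAbove
    exact ⟨N + 1, fun B hB => Nat.lt_succ_of_le (hN ⟨B, hB, rfl⟩)⟩
  have hceil : ∀ r : ℝ, 3 ≤ r → (HereditaryClass.forb F).SOP r →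
      (HereditaryClass.forb F).SOP (⌈r⌉₊ : ℝ) := by
    intro r hr hSOP hNSOP
    refine hSOP (HereditaryClass.nsop_of_contains_free hF hr fun C T _ _ P hP => ?_)
    refine hNSOP.contains_free hF hN (Nat.ceil_pos.2 (by linarith)) hP fun l hl hlr hw => ?_
    exact (Nat.lt_ceil.1 hlr).not_ge (hw.le_of_withinCCW (by linarith) hl)
  have hbdd : ∀ r : ℝ, 3 ≤ r → (HereditaryClass.forb F).SOP r → r ≤ N := by
    intro r hr hSOP
    by_contra! hrN
    refine hSOP (HereditaryClass.nsop_of_contains_free hF hr fun C T _ _ P hP => ?_)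
    refine HereditaryClass.contains_free_of_no_closedWalk hF hN hP fun l hl hlN hw => ?_
    have h₁ := hw.le_of_withinCCW (by linarith) hl
    have h₂ : (l : ℝ) ≤ N := by exact_mod_cast hlN
    linarith
  refine ⟨?_, hceil⟩
  let K : Set ℕ := {k | (3 : ℝ) ≤ k ∧ (HereditaryClass.forb F).SOP k}
  have hK : ∀ r : ℝ, 3 ≤ r → (HereditaryClass.forb F).SOP r → ⌈r⌉₊ ∈ K := fun r hr hSOP =>
    ⟨hr.trans (Nat.le_ceil r), hceil r hr hSOP⟩
  have hKbdd : BddAbove K := ⟨N, fun k hk => by exact_mod_cast hbdd k hk.1 hk.2⟩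
  refine ⟨sSup K, le_antisymm (iSup₂_le fun r hr => ?_) ?_⟩
  · rw [← ENNReal.ofReal_natCast]
    refine ENNReal.ofReal_le_ofReal ((Nat.le_ceil r).trans ?_)
    exact_mod_cast le_csSup hKbdd (hK r hr.1 hr.2)
  · rcases K.eq_empty_or_nonempty with hKe | hKne
    · simp [hKe]
    · rw [← ENNReal.ofReal_natCast]
      exact le_iSup₂_of_le _ (Nat.sSup_mem hKne hKbdd) le_rfl
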